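/- Let $f:[0,1)\to[0,1)$, $f(x)=2x \bmod 1$, be the doubling map, let $\mu$ be Lebesgue measure on $[0,1)$, $d(x,y)=|x-y|$, and let $\rho\equiv 1$. Let $c>1/2$ and $r_n=\dfrac{c\log\log n}{n}$. Then the following hold. (1) The system $([0,1),f,\mu)$ is hyperbolic recurrent with invariant density $\rho$, that is: $\mu$ is an ergodic $f$-invariant probability measure with density $\rho$ of bounded variation with respect to Lebesgue measure, and (A1) there are $C>0$ and $\theta\in(0,1)$ such that for all $\varphi_1$ of bounded variation on $[0,1)$, all $\varphi_2\in L^1(\mu)$ and all $j\ge 0$, $$\Bigl|\int\varphi_1\cdot\varphi_2\circ f^j\,d\mu-\int\varphi_1\,d\mu\int\varphi_2\,d\mu\Bigr|\le C\theta^j\,\|\varphi_1\|_{\mathrm{BV}}\,\|\varphi_2\|_{L^1(\mu)},\qquad \|\varphi\|_{\mathrm{BV}}=\mathrm{var}(\varphi)+\sup|\varphi|;$$ (A2) for every $a>0$ and every real sequence $(s_n)$ for which there is $\kappa>1$ with $\kappa^{-1}n^{-a}\le s_n\le \kappa n^{-a}$ for all large $n$, there are $\beta_0\in(0,1)$ and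 $C>0$ such that for all sufficiently large $n$ and all integers $1\le j\le(\log n)^2$, $$\mu\bigl(\{x\in[0,1):d(x,f^jx)\le s_n\}\bigr)\le C s_n^{\beta_0}.$$ (2) The density $\rho$ is strictly positive, and there is $c'$ with $2c'\min_{x\in[0,1)}\rho(x)>1$ such that $r_n>\dfrac{c'\log\log n}{n}$ for all sufficiently large $n$. (3) For $\mu$-almost every $x\in[0,1)$ there is $N$ such that for all $n\ge N$, $$\min_{1\le k\le n}d(f^kx,x)<r_n .$$ -/

import Mathlib

open MeasureTheory Filter

noncomputable section

/-- The BV norm `var_X(φ) + sup_X |φ|` of a function on `X ⊆ ℝ`, as an extended number. -/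
def bvNorm (X : Set ℝ) (φ : ℝ → ℝ) : ENNReal :=
  eVariationOn φ X + ⨆ x ∈ X, ENNReal.ofReal |φ x|

/-- Exponential decay of correlations, BV against `L¹(μ)`:
`|∫ φ₁ · φ₂ ∘ f^j dμ - ∫ φ₁ dμ ∫ φ₂ dμ| ≤ C θ^j ‖φ₁‖_BV ‖φ₂‖₁` with some `C > 0`, `0 < θ < 1`. -/
def HasExpDecayBVL1 (X : Set ℝ) (f : ℝ → ℝ) (μ : Measure ℝ) : Prop :=
  ∃ C θ : ℝ, 0 < C ∧ 0 < θ ∧ θ < 1 ∧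
    ∀ φ₁ φ₂ : ℝ → ℝ, bvNorm X φ₁ < ⊤ → Integrable φ₂ μ → ∀ j : ℕ,
      |(∫ x, φ₁ x * φ₂ (f^[j] x) ∂μ) - (∫ x, φ₁ x ∂μ) * ∫ x, φ₂ x ∂μ|
        ≤ C * θ ^ j * (bvNorm X φ₁).toReal * ∫ x, |φ₂ x| ∂μ

/-- `E_j(r)`: the points of `X` that are within `r` of their `j`-th iterate. -/
def returnSet (X : Set ℝ) (f : ℝ → ℝ) (j : ℕ) (r : ℝ) : Set ℝ :=
  {x | x ∈ X ∧ dist x (f^[j] x) ≤ r}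

/-- Short return condition: whenever `r_n ≈ n^{-a}` with `a > 0`, there are `β₀ ∈ (0,1)` and `C > 0`
with `μ(E_j(r_n)) ≤ C r_n^{β₀}` for all (large) `n` and all `1 ≤ j ≤ (log n)²`. -/
def HasFewShortReturns (X : Set ℝ) (f : ℝ → ℝ) (μ : Measure ℝ) : Prop :=
  ∀ (a : ℝ) (r : ℕ → ℝ), 0 < a →
    (∃ κ : ℝ, 1 < κ ∧
      ∀ᶠ n : ℕ in atTop, κ⁻¹ * (n : ℝ) ^ (-a) ≤ r n ∧ r n ≤ κ * (n : ℝ) ^ (-a)) →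
    ∃ β₀ C : ℝ, 0 < β₀ ∧ β₀ < 1 ∧ 0 < C ∧
      ∀ᶠ n : ℕ in atTop, ∀ j : ℕ, 1 ≤ j → (j : ℝ) ≤ Real.log n ^ 2 →
        μ.real (returnSet X f j (r n)) ≤ C * r n ^ β₀

/-- The interval system `(X, f, μ)` is hyperbolic recurrent, with invariant density `ρ`.
Functions on `X` are represented by functions on `ℝ`; only their values on `X` matter. -/
structure IsHyperbolicRecurrent (X : Set ℝ) (f : ℝ → ℝ) (μ : Measure ℝ) (ρ : ℝ → ℝ) : Prop where
  ordConnected : X.OrdConnected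
  mapsTo : Set.MapsTo f X X
  isProbabilityMeasure : IsProbabilityMeasure μ
  ergodic : Ergodic f μ
  density_nonneg : ∀ x ∈ X, 0 ≤ ρ x
  density : μ = (volume.restrict X).withDensity (fun x => ENNReal.ofReal (ρ x))
  density_bv : bvNorm X ρ < ⊤
  decay : HasExpDecayBVL1 X f μ
  short_returns : HasFewShortReturns X f μ

/-- The additional hypotheses for the almost sure upper bound with a positive density:
`ρ` is strictly positive on `X`, and `r_n > c' log log n / n` (for large `n`) for some `c'` with
`2 c' min_X ρ > 1`. -/
def IsUpperBoundSequence (X : Set ℝ) (ρ : ℝ → ℝ) (r : ℕ → ℝ) : Prop :=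
  (∀ x ∈ X, 0 < ρ x) ∧
    ∃ m c' : ℝ, IsLeast (ρ '' X) m ∧ 1 < 2 * c' * m ∧
      ∀ᶠ n : ℕ in atTop, c' * Real.log (Real.log n) / n < r n

/-- `min_{1 ≤ k ≤ n} d(f^k x, x)` (a minimum when `n ≥ 1`, see `isLeast_minReturn`). -/
def minReturn (f : ℝ → ℝ) (n : ℕ) (x : ℝ) : ℝ :=
  sInf ((fun k : ℕ => dist (f^[k] x) x) '' Set.Icc 1 n)

theorem isLeast_minReturn (f : ℝ → ℝ) {n : ℕ} (hn : 1 ≤ n) (x : ℝ) :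
    IsLeast ((fun k : ℕ => dist (f^[k] x) x) '' Set.Icc 1 n) (minReturn f n x) := by
  have hfin : ((fun k : ℕ => dist (f^[k] x) x) '' Set.Icc 1 n).Finite :=
    (Set.finite_Icc 1 n).image _
  have hne : ((fun k : ℕ => dist (f^[k] x) x) '' Set.Icc 1 n).Nonempty :=
    (Set.nonempty_Icc.2 hn).image _
  exact ⟨hne.csInf_mem hfin, fun y hy => csInf_le hfin.bddBelow hy⟩

/-- The doubling map `x ↦ 2x mod 1`. -/
def doublingMap (x : ℝ) : ℝ := Int.fract (2 * x)

/-- Lebesgue measure on `[0,1)`. -/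
def lebUnit : Measure ℝ := volume.restrict (Set.Ico 0 1)

end

/-! Everything rests on the `2 ^ M` affine inverse branches of `f^M`: Lebesgue measure is the
average of its images under them (`lebUnit_eq_sum_map`). Decay of correlations follows because the
branch average of a BV function `φ` oscillates by at most `2⁻ʲ var φ`. Ergodicity follows from
decay, and the short return bound from solving `|x - f^j x| ≤ r` on each branch.

For the almost sure bound, split `[0,1)` into dyadic cells of length `2⁻ᴹ` and let `B` be the union
of the cells at index distance at most `m` from a given one. A point of that cell which does not
return within `(m+1)/2^M` must avoid `B` from time `M` on, and that future is exactly independent of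
the cell. Cut the time axis into blocks of length `L + M` and watch only the first `L` times of
each. The blocks are independent, and by a Bonferroni bound each hits `B` with probability at least
`L (μ(B) - S)`, where `S` sums the short-return correlations `μ(B ∩ f⁻ʲB)`. So `q` blocks all miss
with probability at most `exp(-q L (μ(B) - S))`. Averaged over cells, `S` is small by the short
return bound, so Markov's inequality discards the bad cells (`measureReal_noReturnSet_le`).

Take times `l^k` with `1 < l < min 2 (2c)`, `M = k` and `L = k²`. Then `q L ~ l^k` and `μ(B) ~ 2 c
log k / l^(k+1)`, so the main term is at most `k^(-γ)` with `γ > 1`, and the discarded part is at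
most a polynomial times `l^(-k)`. Borel–Cantelli along `l^k` and monotonicity in between finish the
proof. -/

instance isProbabilityMeasure_lebUnit : IsProbabilityMeasure lebUnit := by
  constructor
  simp [lebUnit]

theorem ae_lebUnit_mem : ∀ᵐ x ∂lebUnit, x ∈ Set.Ico (0 : ℝ) 1 :=
  ae_restrict_mem measurableSet_Ico

theorem measurable_doublingMap : Measurable doublingMap :=
  measurable_fract.comp (measurable_const.mul measurable_id)

theorem measurable_iterate_doublingMap (j : ℕ) : Measurable (doublingMap^[j]) :=
  measurable_doublingMap.iterate j

theorem doublingMap_mem (x : ℝ) : doublingMap x ∈ Set.Ico (0 : ℝ) 1 :=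
  ⟨Int.fract_nonneg _, Int.fract_lt_one _⟩

theorem iterate_doublingMap_eq {x : ℝ} (hx : x ∈ Set.Ico (0 : ℝ) 1) (j : ℕ) :
    doublingMap^[j] x = Int.fract (2 ^ j * x) := by
  induction j with
  | zero => simpa using (Int.fract_eq_self.2 hx).symm
  | succ j ih =>
    rw [Function.iterate_succ_apply', ih, doublingMap, Int.fract_eq_fract]
    refine ⟨-(2 * ⌊2 ^ j * x⌋), ?_⟩
    have := Int.floor_add_fract (2 ^ j * x)
    push_cast
    rw [pow_succ]
    linarith

theorem iterate_doublingMap_mem {x : ℝ} (hx : x ∈ Set.Ico (0 : ℝ) 1) (j : ℕ) :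
    doublingMap^[j] x ∈ Set.Ico (0 : ℝ) 1 := by
  rw [iterate_doublingMap_eq hx]
  exact ⟨Int.fract_nonneg _, Int.fract_lt_one _⟩

/-! ### Inverse branches and invariance of Lebesgue measure. -/

/-- The `k`-th inverse branch of the `M`-th iterate of the doubling map. -/
noncomputable def invBranch (M k : ℕ) (y : ℝ) : ℝ := (y + k) / 2 ^ M

theorem measurable_invBranch (M k : ℕ) : Measurable (invBranch M k) := by
  unfold invBranch
  fun_prop

theorem floor_invBranch (M k : ℕ) {y : ℝ} (hy : y ∈ Set.Ico (0 : ℝ) 1) :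
    ⌊2 ^ M * invBranch M k y⌋ = k := by
  have : (2 : ℝ) ^ M * invBranch M k y = y + k := by unfold invBranch; field_simp
  rw [this, Int.floor_add_natCast, Int.floor_eq_zero_iff.2 hy, zero_add]

theorem invBranch_mem {M k : ℕ} (hk : k < 2 ^ M) {y : ℝ} (hy : y ∈ Set.Ico (0 : ℝ) 1) :
    invBranch M k y ∈ Set.Ico (0 : ℝ) 1 := by
  have h2 : (0 : ℝ) < 2 ^ M := by positivity
  have hk' : (k : ℝ) + 1 ≤ 2 ^ M := by exact_mod_cast hk
  have := hy.1
  have := hy.2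
  refine ⟨by unfold invBranch; positivity, ?_⟩
  rw [invBranch, div_lt_one h2]
  linarith

theorem iterate_invBranch {M k : ℕ} (hk : k < 2 ^ M) {y : ℝ} (hy : y ∈ Set.Ico (0 : ℝ) 1) :
    doublingMap^[M] (invBranch M k y) = y := by
  rw [iterate_doublingMap_eq (invBranch_mem hk hy)]
  have : (2 : ℝ) ^ M * invBranch M k y = y + k := by unfold invBranch; field_simp
  rw [this, Int.fract_add_natCast, Int.fract_eq_self.2 hy]

theorem map_invBranch_lebUnit (M k : ℕ) :
    lebUnit.map (invBranch M k) =
      (2 ^ M : ENNReal) • volume.restrict (Set.Ico ((k : ℝ) / 2 ^ M) ((k + 1) / 2 ^ M)) := by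
  have h2 : (0 : ℝ) < 2 ^ M := by positivity
  ext s hs
  rw [Measure.map_apply (measurable_invBranch M k) hs, lebUnit,
    Measure.restrict_apply (measurable_invBranch M k hs), Measure.smul_apply,
    Measure.restrict_apply hs]
  have : invBranch M k ⁻¹' s ∩ Set.Ico 0 1
      = (fun y => y + (k : ℝ)) ⁻¹' ((fun y => (2 ^ M)⁻¹ * y) ⁻¹'
        (s ∩ Set.Ico ((k : ℝ) / 2 ^ M) ((k + 1) / 2 ^ M))) := by
    ext y
    have e : (2 ^ M)⁻¹ * (y + (k : ℝ)) = (y + k) / 2 ^ M := by field_simp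
    simp only [Set.mem_inter_iff, Set.mem_preimage, Set.mem_Ico, invBranch, e,
      div_le_div_iff_of_pos_right h2, div_lt_div_iff_of_pos_right h2]
    constructor
    · rintro ⟨h, h0, h1⟩; exact ⟨h, by linarith, by linarith⟩
    · rintro ⟨h, h0, h1⟩; exact ⟨h, by linarith, by linarith⟩
  rw [this, measure_preimage_add_right, Real.volume_preimage_mul_left (by positivity), inv_inv,
    abs_of_pos h2, ENNReal.ofReal_pow (by norm_num)]
  simp

/-- Each branch carries `[0,1)` affinely onto one of `2 ^ M` adjacent dyadic intervals. Stated for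
measures, it serves both integrals and measures of sets. -/
theorem lebUnit_eq_sum_map (M : ℕ) :
    (2 ^ M : ENNReal) • lebUnit = ∑ k ∈ Finset.range (2 ^ M), lebUnit.map (invBranch M k) := by
  have key : ∀ n : ℕ, volume.restrict (Set.Ico (0 : ℝ) (n / 2 ^ M)) =
      ∑ k ∈ Finset.range n,
        volume.restrict (Set.Ico ((k : ℝ) / 2 ^ M) ((k + 1) / 2 ^ M)) := by
    intro n
    induction n with
    | zero => simp
    | succ n ih =>
      rw [Finset.sum_range_succ, ← ih, ← Measure.restrict_union _ measurableSet_Ico,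
        Set.Ico_union_Ico_eq_Ico (by positivity) (by gcongr; linarith)]
      · push_cast; rfl
      · rw [Set.disjoint_left]
        intro x hx hx'
        exact absurd hx.2 (not_lt.2 hx'.1)
  simp_rw [map_invBranch_lebUnit]
  rw [← Finset.smul_sum, ← key]
  simp [lebUnit]

theorem integral_lebUnit_eq_sum (M : ℕ) {g : ℝ → ℝ} (hg : Integrable g lebUnit) :
    ∫ x, g x ∂lebUnit =
      (2 ^ M)⁻¹ * ∑ k ∈ Finset.range (2 ^ M), ∫ y, g (invBranch M k y) ∂lebUnit := by
  have h2 : (2 : ℝ) ^ M ≠ 0 := by positivity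
  have hg' : Integrable g ((2 ^ M : ENNReal) • lebUnit) := hg.smul_measure (by finiteness)
  have hgk : ∀ k ∈ Finset.range (2 ^ M), Integrable g (lebUnit.map (invBranch M k)) := by
    rw [lebUnit_eq_sum_map] at hg'
    exact integrable_finsetSum_measure.1 hg'
  have := congrArg (fun ν => ∫ x, g x ∂ν) (lebUnit_eq_sum_map M)
  simp only [integral_smul_measure] at this
  rw [integral_finsetSum_measure hgk] at this
  rw [eq_inv_mul_iff_mul_eq₀ h2]
  simp only [ENNReal.toReal_pow, ENNReal.toReal_ofNat, smul_eq_mul] at this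
  rw [this]
  refine Finset.sum_congr rfl fun k hk => ?_
  exact integral_map (measurable_invBranch M k).aemeasurable (hgk k hk).aestronglyMeasurable

theorem integrable_comp_invBranch {M k : ℕ} (hk : k < 2 ^ M) {g : ℝ → ℝ}
    (hg : Integrable g lebUnit) : Integrable (fun y => g (invBranch M k y)) lebUnit := by
  have hg' : Integrable g ((2 ^ M : ENNReal) • lebUnit) := hg.smul_measure (by finiteness)
  rw [lebUnit_eq_sum_map] at hg'
  exact (integrable_finsetSum_measure.1 hg' k (Finset.mem_range.2 hk)).comp_measurable
    (measurable_invBranch M k)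

theorem measureReal_lebUnit_eq_sum (M : ℕ) {T : Set ℝ} (hT : MeasurableSet T) :
    lebUnit.real T =
      (2 ^ M)⁻¹ * ∑ k ∈ Finset.range (2 ^ M), lebUnit.real (invBranch M k ⁻¹' T) := by
  have h2 : (2 : ℝ) ^ M ≠ 0 := by positivity
  have := congrArg (fun ν : Measure ℝ => (ν T).toReal) (lebUnit_eq_sum_map M)
  simp only [Measure.smul_apply, Measure.coe_finsetSum, Finset.sum_apply, smul_eq_mul,
    ENNReal.toReal_mul, ENNReal.toReal_pow, ENNReal.toReal_ofNat] at this
  rw [eq_inv_mul_iff_mul_eq₀ h2, Measure.real, this, ENNReal.toReal_sum]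
  · refine Finset.sum_congr rfl fun k hk => ?_
    rw [Measure.map_apply (measurable_invBranch M k) hT, Measure.real]
  · intro k _
    rw [Measure.map_apply (measurable_invBranch M k) hT]
    exact measure_ne_top _ _

theorem measurePreserving_doublingMap : MeasurePreserving doublingMap lebUnit lebUnit := by
  refine ⟨measurable_doublingMap, ?_⟩
  ext s hs
  rw [Measure.map_apply measurable_doublingMap hs,
    ← ENNReal.toReal_eq_toReal_iff' (measure_ne_top _ _) (measure_ne_top _ _)]
  change lebUnit.real _ = lebUnit.real _
  rw [measureReal_lebUnit_eq_sum 1 (measurable_doublingMap hs)]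
  have : ∀ k ∈ Finset.range (2 ^ 1),
      lebUnit.real (invBranch 1 k ⁻¹' (doublingMap ⁻¹' s)) = lebUnit.real s := by
    intro k hk
    refine measureReal_congr ?_
    filter_upwards [ae_lebUnit_mem] with y hy
    have := iterate_invBranch (Finset.mem_range.1 hk) hy
    rw [Function.iterate_one] at this
    change (doublingMap (invBranch 1 k y) ∈ s) = (y ∈ s)
    rw [this]
  rw [Finset.sum_congr rfl this]
  simp

theorem measurePreserving_iterate_doublingMap (j : ℕ) :
    MeasurePreserving (doublingMap^[j]) lebUnit lebUnit :=
  measurePreserving_doublingMap.iterate j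

/-! ### Transfer operator and decay of correlations. -/

/-- The two preimages under branch `k` lie in the same dyadic interval, and variation is
superadditive over successive intervals. -/
theorem sum_ofReal_invBranch_le_eVariationOn (φ : ℝ → ℝ) (M : ℕ) {y z : ℝ}
    (hy : y ∈ Set.Ico (0 : ℝ) 1) (hz : z ∈ Set.Ico (0 : ℝ) 1) (n : ℕ) :
    ∑ k ∈ Finset.range n, ENNReal.ofReal |φ (invBranch M k y) - φ (invBranch M k z)| ≤
      eVariationOn φ (Set.Ico 0 (n / 2 ^ M)) := by
  have h2 : (0 : ℝ) < 2 ^ M := by positivity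
  induction n with
  | zero => simp
  | succ n ih =>
    have hmem : ∀ w ∈ Set.Ico (0 : ℝ) 1, invBranch M n w ∈
        Set.Ico ((n : ℝ) / 2 ^ M) ((n + 1 : ℕ) / 2 ^ M) := by
      intro w hw
      have := hw.1
      have := hw.2
      unfold invBranch
      push_cast
      exact ⟨div_le_div_of_nonneg_right (by linarith) h2.le,
      div_lt_div_of_pos_right (by linarith) h2⟩
    have hlast : ENNReal.ofReal |φ (invBranch M n y) - φ (invBranch M n z)| ≤
        eVariationOn φ (Set.Ico ((n : ℝ) / 2 ^ M) ((n + 1 : ℕ) / 2 ^ M)) := by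
      rw [← Real.dist_eq, ← edist_dist]
      exact eVariationOn.edist_le φ (hmem y hy) (hmem z hz)
    rw [Finset.sum_range_succ]
    refine (add_le_add ih hlast).trans ?_
    refine (eVariationOn.add_le_union φ fun x hx y hy => hx.2.le.trans hy.1).trans ?_
    rw [Set.Ico_union_Ico_eq_Ico (by positivity) (by push_cast; gcongr; linarith)]

theorem sum_abs_invBranch_le {φ : ℝ → ℝ} (hφ : bvNorm (Set.Ico 0 1) φ < ⊤) (M : ℕ) {y z : ℝ}
    (hy : y ∈ Set.Ico (0 : ℝ) 1) (hz : z ∈ Set.Ico (0 : ℝ) 1) :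
    ∑ k ∈ Finset.range (2 ^ M), |φ (invBranch M k y) - φ (invBranch M k z)| ≤
      (bvNorm (Set.Ico 0 1) φ).toReal := by
  have h := sum_ofReal_invBranch_le_eVariationOn φ M hy hz (2 ^ M)
  push_cast at h
  rw [div_self (by positivity)] at h
  rw [← ENNReal.ofReal_sum_of_nonneg fun _ _ => abs_nonneg _] at h
  exact (ENNReal.ofReal_le_iff_le_toReal hφ.ne).1 (h.trans le_self_add)

theorem abs_le_bvNorm {X : Set ℝ} {φ : ℝ → ℝ} (hφ : bvNorm X φ < ⊤) {x : ℝ} (hx : x ∈ X) :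
    |φ x| ≤ (bvNorm X φ).toReal := by
  rw [← ENNReal.ofReal_le_iff_le_toReal hφ.ne]
  exact (le_iSup₂ (f := fun x (_ : x ∈ X) => ENNReal.ofReal |φ x|) x hx).trans le_add_self

theorem aestronglyMeasurable_of_bvNorm {φ : ℝ → ℝ} (hφ : bvNorm (Set.Ico 0 1) φ < ⊤) :
    AEStronglyMeasurable φ lebUnit := by
  have hv : BoundedVariationOn φ (Set.Ico 0 1) := (le_self_add.trans_lt hφ).ne
  -- Measurability comes from the Jordan decomposition into monotone functions.
  obtain ⟨p, q, hp, hq, rfl⟩ := hv.locallyBoundedVariationOn.exists_monotoneOn_sub_monotoneOn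
  exact ((aemeasurable_restrict_of_monotoneOn measurableSet_Ico hp).sub
    (aemeasurable_restrict_of_monotoneOn measurableSet_Ico hq)).aestronglyMeasurable

theorem integrable_of_bvNorm {φ : ℝ → ℝ} (hφ : bvNorm (Set.Ico 0 1) φ < ⊤) :
    Integrable φ lebUnit := by
  refine Integrable.of_bound (aestronglyMeasurable_of_bvNorm hφ)
    (bvNorm (Set.Ico 0 1) φ).toReal ?_
  filter_upwards [ae_lebUnit_mem] with x hx using abs_le_bvNorm hφ hx

/-- The transfer operator of the `j`-th iterate of the doubling map. -/
noncomputable def transferOp (j : ℕ) (φ : ℝ → ℝ) (y : ℝ) : ℝ :=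
  (2 ^ j)⁻¹ * ∑ k ∈ Finset.range (2 ^ j), φ (invBranch j k y)

theorem integrable_transferOp (j : ℕ) {φ : ℝ → ℝ} (hφ : Integrable φ lebUnit) :
    Integrable (transferOp j φ) lebUnit :=
  (integrable_finsetSum _ fun _ hk =>
    integrable_comp_invBranch (Finset.mem_range.1 hk) hφ).const_mul _

theorem integral_transferOp (j : ℕ) {φ : ℝ → ℝ} (hφ : Integrable φ lebUnit) :
    ∫ y, transferOp j φ y ∂lebUnit = ∫ x, φ x ∂lebUnit := by
  rw [integral_lebUnit_eq_sum j hφ]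
  unfold transferOp
  rw [integral_const_mul, integral_finsetSum _ fun _ hk =>
    integrable_comp_invBranch (Finset.mem_range.1 hk) hφ]

/-- The operator preserves the integral, so the deviation from the mean is an average over `z` of
differences between the values at `y` and `z`; each is at most `2⁻ʲ` times the variation. -/
theorem abs_transferOp_sub_le (j : ℕ) {φ : ℝ → ℝ} (hφ : bvNorm (Set.Ico 0 1) φ < ⊤) {y : ℝ}
    (hy : y ∈ Set.Ico (0 : ℝ) 1) :
    |transferOp j φ y - ∫ x, φ x ∂lebUnit| ≤
      (1 / 2) ^ j * (bvNorm (Set.Ico 0 1) φ).toReal := by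
  have hint := integrable_of_bvNorm hφ
  have hy2 : transferOp j φ y - ∫ x, φ x ∂lebUnit =
      ∫ z, (transferOp j φ y - transferOp j φ z) ∂lebUnit := by
    rw [integral_sub (integrable_const _) (integrable_transferOp j hint),
      integral_transferOp j hint]
    simp
  rw [hy2]
  have : ∀ᵐ z ∂lebUnit, ‖transferOp j φ y - transferOp j φ z‖ ≤
      (1 / 2) ^ j * (bvNorm (Set.Ico 0 1) φ).toReal := by
    filter_upwards [ae_lebUnit_mem] with z hz
    unfold transferOp
    rw [← mul_sub, ← Finset.sum_sub_distrib, norm_mul, Real.norm_of_nonneg (by positivity),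
      one_div, inv_pow]
    gcongr
    exact (Finset.abs_sum_le_sum_abs _ _).trans (sum_abs_invBranch_le hφ j hy hz)
  simpa using norm_integral_le_of_norm_le_const this

theorem integral_mul_comp_iterate (j : ℕ) {φ₁ φ₂ : ℝ → ℝ} (h₁ : bvNorm (Set.Ico 0 1) φ₁ < ⊤)
    (h₂ : Integrable φ₂ lebUnit) :
    ∫ x, φ₁ x * φ₂ (doublingMap^[j] x) ∂lebUnit = ∫ y, transferOp j φ₁ y * φ₂ y ∂lebUnit := by
  have hi₁ := integrable_of_bvNorm h₁
  have hcomp : Integrable (fun x => φ₂ (doublingMap^[j] x)) lebUnit :=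
    (measurePreserving_iterate_doublingMap j).integrable_comp_of_integrable h₂
  have hprod : Integrable (fun x => φ₁ x * φ₂ (doublingMap^[j] x)) lebUnit := by
    refine hcomp.bdd_mul hi₁.aestronglyMeasurable (c := (bvNorm (Set.Ico 0 1) φ₁).toReal) ?_
    filter_upwards [ae_lebUnit_mem] with x hx using abs_le_bvNorm h₁ hx
  have hk : ∀ k ∈ Finset.range (2 ^ j), (fun y => φ₁ (invBranch j k y) *
      φ₂ (doublingMap^[j] (invBranch j k y))) =ᵐ[lebUnit]
      fun y => φ₁ (invBranch j k y) * φ₂ y := by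
    intro k hk
    filter_upwards [ae_lebUnit_mem] with y hy
    rw [iterate_invBranch (Finset.mem_range.1 hk) hy]
  rw [integral_lebUnit_eq_sum j hprod, Finset.sum_congr rfl fun k h => integral_congr_ae (hk k h),
    ← integral_finsetSum, ← integral_const_mul]
  · simp only [transferOp, mul_assoc, Finset.sum_mul]
  · intro k h
    exact (integrable_comp_invBranch (Finset.mem_range.1 h) hprod).congr (hk k h)

theorem hasExpDecayBVL1_doublingMap :
    HasExpDecayBVL1 (Set.Ico 0 1) doublingMap lebUnit := by
  refine ⟨1, 1 / 2, one_pos, by norm_num, by norm_num, fun φ₁ φ₂ h₁ h₂ j => ?_⟩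
  have hi₁ := integrable_of_bvNorm h₁
  have hbd : ∀ᵐ y ∂lebUnit, ‖transferOp j φ₁ y - ∫ x, φ₁ x ∂lebUnit‖ ≤
      (1 / 2) ^ j * (bvNorm (Set.Ico 0 1) φ₁).toReal := by
    filter_upwards [ae_lebUnit_mem] with y hy using abs_transferOp_sub_le j h₁ hy
  have hD : Integrable (fun y => (transferOp j φ₁ y - ∫ x, φ₁ x ∂lebUnit) * φ₂ y) lebUnit :=
    h₂.bdd_mul ((integrable_transferOp j hi₁).sub (integrable_const _)).aestronglyMeasurable hbd
  have hC : Integrable (fun y => (∫ x, φ₁ x ∂lebUnit) * φ₂ y) lebUnit := h₂.const_mul _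
  have hdiff : (∫ x, φ₁ x * φ₂ (doublingMap^[j] x) ∂lebUnit) -
      (∫ x, φ₁ x ∂lebUnit) * ∫ x, φ₂ x ∂lebUnit =
      ∫ y, (transferOp j φ₁ y - ∫ x, φ₁ x ∂lebUnit) * φ₂ y ∂lebUnit := by
    rw [integral_mul_comp_iterate j h₁ h₂, ← integral_const_mul, sub_eq_iff_eq_add,
      ← integral_add hD hC]
    congr 1
    ext y
    ring
  rw [hdiff, one_mul, ← integral_const_mul]
  rw [← Real.norm_eq_abs]
  refine norm_integral_le_of_norm_le (h₂.abs.const_mul _) ?_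
  filter_upwards [hbd] with y hy
  rw [norm_mul]
  exact mul_le_mul_of_nonneg_right hy (abs_nonneg _)

/-! ### Ergodicity. -/

theorem bvNorm_indicator_Ici_lt_top (a : ℝ) :
    bvNorm (Set.Ico 0 1) ((Set.Ici a).indicator fun _ => (1 : ℝ)) < ⊤ := by
  have hmono : Monotone ((Set.Ici a).indicator fun _ => (1 : ℝ)) := by
    intro x y hxy
    by_cases hx : a ≤ x
    · simp [hx, hx.trans hxy]
    · rw [Set.indicator_of_notMem (by simpa using hx)]
      exact Set.indicator_nonneg (fun _ _ => zero_le_one) _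
  refine ENNReal.add_lt_top.2 ⟨?_, ?_⟩
  · refine (eVariationOn.mono _ (s := Set.univ ∩ Set.Icc (0 : ℝ) 1) fun x hx =>
      ⟨Set.mem_univ x, hx.1, hx.2.le⟩).trans_lt ?_
    exact ((hmono.monotoneOn Set.univ).eVariationOn_eq trivial trivial).trans_lt
      ENNReal.ofReal_lt_top
  · refine lt_of_le_of_lt (iSup₂_le fun x _ => ?_) (ENNReal.one_lt_top)
    rw [ENNReal.ofReal_le_one]
    by_cases hx : a ≤ x <;> simp [Set.indicator, hx]

theorem ergodic_doublingMap : Ergodic doublingMap lebUnit := by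
  refine ⟨measurePreserving_doublingMap, ⟨fun s hs hinv => ?_⟩⟩
  have hiter : ∀ j, doublingMap^[j] ⁻¹' s = s := fun j => by
    rw [Set.preimage_iterate_eq]
    exact Function.iterate_fixed hinv j
  obtain ⟨C, θ, _, hθ, hθ1, hdecay⟩ := hasExpDecayBVL1_doublingMap
  -- For invariant `s` the correlation with a half-line does not depend on `j`, so exponential decay
  -- forces it to vanish. Half-lines are BV and determine a finite measure, which makes `s`
  -- independent of itself.
  have hind : ∀ a, lebUnit.real (Set.Ici a ∩ s) = lebUnit.real (Set.Ici a) * lebUnit.real s := by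
    intro a
    have hbv := bvNorm_indicator_Ici_lt_top a
    have hi : Integrable (s.indicator fun _ => (1 : ℝ)) lebUnit :=
      (integrable_const 1).indicator hs
    have hle := fun j => hdecay _ _ hbv hi j
    have hprod : ∀ j x, (Set.Ici a).indicator (fun _ => (1 : ℝ)) x *
        s.indicator (fun _ => (1 : ℝ)) (doublingMap^[j] x) =
        (Set.Ici a ∩ s).indicator (fun _ => (1 : ℝ)) x := by
      intro j x
      have hx : doublingMap^[j] x ∈ s ↔ x ∈ s := by
        rw [← Set.mem_preimage, hiter j]
      by_cases h1 : x ∈ Set.Ici a <;> by_cases h2 : x ∈ s <;> simp_all [Set.indicator]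
    simp only [hprod] at hle
    simp only [integral_indicator_const _ (measurableSet_Ici.inter hs),
      integral_indicator_const _ hs, integral_indicator_const _ measurableSet_Ici, smul_eq_mul,
      mul_one] at hle
    have hlim : Tendsto (fun j : ℕ => C * θ ^ j *
        (bvNorm (Set.Ico 0 1) ((Set.Ici a).indicator fun _ => (1 : ℝ))).toReal *
        ∫ x, |s.indicator (fun _ => (1 : ℝ)) x| ∂lebUnit) atTop (nhds 0) := by
      have := (((tendsto_pow_atTop_nhds_zero_of_lt_one hθ.le hθ1).const_mul C).mul_const
        (bvNorm (Set.Ico 0 1) ((Set.Ici a).indicator fun _ => (1 : ℝ))).toReal).mul_const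
        (∫ x, |s.indicator (fun _ => (1 : ℝ)) x| ∂lebUnit)
      simpa using this
    have := ge_of_tendsto' hlim hle
    exact sub_eq_zero.1 (abs_eq_zero.1 (le_antisymm this (abs_nonneg _)))
  have hmeas : lebUnit.restrict s = lebUnit s • lebUnit := by
    refine Measure.ext_of_Ici _ _ fun a => ?_
    rw [Measure.restrict_apply measurableSet_Ici, Measure.smul_apply, smul_eq_mul,
      ← ENNReal.toReal_eq_toReal_iff' (by finiteness) (by finiteness), ENNReal.toReal_mul, mul_comm]
    exact hind a
  have hsq : lebUnit s = lebUnit s * lebUnit s := by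
    have := congrArg (fun ν : Measure ℝ => ν s) hmeas
    simpa using this
  rw [eventuallyConst_set']
  by_cases h0 : lebUnit s = 0
  · left
    rwa [ae_eq_empty]
  · right
    rw [ae_eq_univ, prob_compl_eq_zero_iff hs]
    exact ((ENNReal.mul_eq_left h0 (measure_ne_top _ _)).1 hsq.symm)

/-! ### Short returns and hyperbolic recurrence. -/

theorem measureReal_lebUnit_Icc_le {a b : ℝ} (h : a ≤ b) : lebUnit.real (Set.Icc a b) ≤ b - a := by
  calc lebUnit.real (Set.Icc a b) ≤ volume.real (Set.Icc a b) :=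
        ENNReal.toReal_mono (by simp) (Measure.restrict_apply_le _ _)
    _ = b - a := Real.volume_real_Icc_of_le h

theorem measurableSet_returnSet (j : ℕ) (r : ℝ) :
    MeasurableSet (returnSet (Set.Ico 0 1) doublingMap j r) :=
  measurableSet_Ico.inter (measurableSet_le
    (measurable_id.dist (measurable_iterate_doublingMap j)) measurable_const)

/-- On branch `k` the condition reads `|(2^j - 1) y - k| ≤ 2^j r`, an interval of length `2 · 2^j r
/ (2^j - 1)`, which is at most `4 r` since `2^j ≥ 2`. -/
theorem measureReal_returnSet_le {j : ℕ} (hj : 1 ≤ j) {r : ℝ} (hr : 0 ≤ r) :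
    lebUnit.real (returnSet (Set.Ico 0 1) doublingMap j r) ≤ 4 * r := by
  have h2 : (2 : ℝ) ≤ 2 ^ j := by
    simpa using pow_le_pow_right₀ (one_le_two (α := ℝ)) hj
  have hpos : (0 : ℝ) < 2 ^ j - 1 := by linarith
  rw [measureReal_lebUnit_eq_sum j (measurableSet_returnSet j r)]
  have : ∀ k ∈ Finset.range (2 ^ j), lebUnit.real
      (invBranch j k ⁻¹' returnSet (Set.Ico 0 1) doublingMap j r) ≤ 4 * r := by
    intro k hk
    have hsub : (invBranch j k ⁻¹' returnSet (Set.Ico 0 1) doublingMap j r) ≤ᵐ[lebUnit]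
        Set.Icc ((k - 2 ^ j * r) / (2 ^ j - 1)) ((k + 2 ^ j * r) / (2 ^ j - 1)) := by
      filter_upwards [ae_lebUnit_mem] with y hy hmem
      have hd := hmem.2
      rw [iterate_invBranch (Finset.mem_range.1 hk) hy, Real.dist_eq, invBranch, abs_le,
        le_sub_iff_add_le, sub_le_iff_le_add, le_div_iff₀ (by positivity),
        div_le_iff₀ (by positivity)] at hd
      change _ ∧ _
      rw [div_le_iff₀ hpos, le_div_iff₀ hpos]
      constructor <;> linarith [hd.1, hd.2]
    calc _ ≤ _ := ENNReal.toReal_mono (measure_ne_top _ _) (measure_mono_ae hsub)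
      _ ≤ _ := measureReal_lebUnit_Icc_le (by
        gcongr; linarith [show (0 : ℝ) ≤ 2 ^ j * r by positivity])
      _ = 2 * 2 ^ j * r / (2 ^ j - 1) := by ring
      _ ≤ 4 * r := by
        rw [div_le_iff₀ hpos]
        nlinarith
  calc _ ≤ ((2 : ℝ) ^ j)⁻¹ * ∑ k ∈ Finset.range (2 ^ j), 4 * r := by
        gcongr with k hk; exact this k hk
    _ = 4 * r := by simp

theorem hasFewShortReturns_doublingMap :
    HasFewShortReturns (Set.Ico 0 1) doublingMap lebUnit := by
  rintro a r ha ⟨κ, hκ, hr⟩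
  -- The linear bound `4 r` is stronger than needed: any exponent below `1` works once `r n ≤ 1`.
  refine ⟨1 / 2, 4, by norm_num, by norm_num, by norm_num, ?_⟩
  have hlim : Tendsto (fun n : ℕ => κ * (n : ℝ) ^ (-a)) atTop (nhds 0) := by
    simpa using ((tendsto_rpow_neg_atTop ha).comp tendsto_natCast_atTop_atTop).const_mul κ
  filter_upwards [hr, hlim.eventually (gt_mem_nhds one_pos)] with n hn h1 j hj _
  have h0 : 0 ≤ r n := le_trans (by positivity) hn.1
  refine (measureReal_returnSet_le hj h0).trans ?_
  gcongr
  conv_lhs => rw [← Real.rpow_one (r n)]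
  exact Real.rpow_le_rpow_of_exponent_ge_of_imp h0 (hn.2.trans h1.le) (by norm_num) (by norm_num)

theorem isHyperbolicRecurrent_doublingMap :
    IsHyperbolicRecurrent (Set.Ico 0 1) doublingMap lebUnit (fun _ => 1) where
  ordConnected := Set.ordConnected_Ico
  mapsTo := fun x _ => doublingMap_mem x
  isProbabilityMeasure := inferInstance
  ergodic := ergodic_doublingMap
  density_nonneg := fun _ _ => zero_le_one
  density := by simp [lebUnit]
  density_bv := by
    have h1 : Set.EqOn (fun _ => (1 : ℝ)) ((Set.Ici (0 : ℝ)).indicator fun _ => (1 : ℝ))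
        (Set.Ico 0 1) := fun x hx =>
      (Set.indicator_of_mem (Set.mem_Ici.2 hx.1) (fun _ => (1 : ℝ))).symm
    refine (add_le_add (eVariationOn.eq_of_eqOn h1).le
      (iSup₂_mono fun x hx => (congrArg (fun t => ENNReal.ofReal |t|) (h1 hx)).le)).trans_lt
      (bvNorm_indicator_Ici_lt_top 0)
  decay := hasExpDecayBVL1_doublingMap
  short_returns := hasFewShortReturns_doublingMap

/-! ### Dyadic sets and exact independence. -/

/-- Within `[0,1)`, the set `D` is a union of dyadic intervals of length `2⁻ᴾ`. -/
structure IsDyadicSet (P : ℕ) (D : Set ℝ) : Prop where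
  measurableSet : MeasurableSet D
  mem_iff : ∀ x ∈ Set.Ico (0 : ℝ) 1, ∀ y ∈ Set.Ico (0 : ℝ) 1,
    ⌊2 ^ P * x⌋ = ⌊2 ^ P * y⌋ → (x ∈ D ↔ y ∈ D)

theorem floor_two_pow_mul_eq_of_le {P Q : ℕ} (h : P ≤ Q) {x y : ℝ}
    (hxy : ⌊2 ^ Q * x⌋ = ⌊2 ^ Q * y⌋) : ⌊2 ^ P * x⌋ = ⌊2 ^ P * y⌋ := by
  have key : ∀ z : ℝ, ⌊2 ^ P * z⌋ = ⌊2 ^ Q * z⌋ / ((2 ^ (Q - P) : ℕ) : ℤ) := by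
    intro z
    rw [← Int.floor_div_natCast]
    congr 1
    rw [eq_div_iff (by positivity)]
    push_cast
    rw [mul_right_comm, ← pow_add, Nat.add_sub_cancel' h]
  rw [key, key, hxy]

theorem floor_two_pow_mul_iterate (P j : ℕ) {x : ℝ} (hx : x ∈ Set.Ico (0 : ℝ) 1) :
    ⌊2 ^ P * doublingMap^[j] x⌋ = ⌊2 ^ (P + j) * x⌋ - 2 ^ P * ⌊2 ^ j * x⌋ := by
  rw [iterate_doublingMap_eq hx, Int.fract, mul_sub, ← mul_assoc, ← pow_add]
  have : (2 : ℝ) ^ P * (⌊2 ^ j * x⌋ : ℝ) = ((2 ^ P * ⌊2 ^ j * x⌋ : ℤ) : ℝ) := by push_cast; rfl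
  rw [this, Int.floor_sub_intCast]

namespace IsDyadicSet

variable {P Q : ℕ} {D : Set ℝ}

theorem mono (hD : IsDyadicSet P D) (h : P ≤ Q) : IsDyadicSet Q D :=
  ⟨hD.measurableSet, fun x hx y hy hxy =>
    hD.mem_iff x hx y hy (floor_two_pow_mul_eq_of_le h hxy)⟩

theorem compl (hD : IsDyadicSet P D) : IsDyadicSet P Dᶜ :=
  ⟨hD.measurableSet.compl, fun x hx y hy hxy => not_congr (hD.mem_iff x hx y hy hxy)⟩

theorem iInter {ι : Type*} [Countable ι] {D : ι → Set ℝ} (hD : ∀ i, IsDyadicSet P (D i)) :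
    IsDyadicSet P (⋂ i, D i) :=
  ⟨MeasurableSet.iInter fun i => (hD i).measurableSet, fun x hx y hy hxy => by
    simp only [Set.mem_iInter]
    exact forall_congr' fun i => (hD i).mem_iff x hx y hy hxy⟩

theorem preimage_iterate (hD : IsDyadicSet P D) (j : ℕ) :
    IsDyadicSet (P + j) (doublingMap^[j] ⁻¹' D) :=
  ⟨measurable_iterate_doublingMap j hD.measurableSet, fun x hx y hy hxy =>
    hD.mem_iff _ (iterate_doublingMap_mem hx j) _ (iterate_doublingMap_mem hy j) (by
      rw [floor_two_pow_mul_iterate P j hx, floor_two_pow_mul_iterate P j hy, hxy,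
        floor_two_pow_mul_eq_of_le (Nat.le_add_left j P) hxy])⟩

theorem measureReal_preimage_invBranch (hD : IsDyadicSet P D) {A : Set ℝ} {k : ℕ}
    (hk : k < 2 ^ P) :
    lebUnit.real (invBranch P k ⁻¹' (D ∩ doublingMap^[P] ⁻¹' A)) =
      (D.indicator (fun _ => 1) (invBranch P k 0)) * lebUnit.real A := by
  have h0 : (0 : ℝ) ∈ Set.Ico (0 : ℝ) 1 := by simp
  have hmem : ∀ y ∈ Set.Ico (0 : ℝ) 1, (invBranch P k y ∈ D ↔ invBranch P k 0 ∈ D) := by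
    intro y hy
    exact hD.mem_iff _ (invBranch_mem hk hy) _ (invBranch_mem hk h0)
      (by rw [floor_invBranch P k hy, floor_invBranch P k h0])
  by_cases h : invBranch P k 0 ∈ D
  · rw [Set.indicator_of_mem h, one_mul]
    refine measureReal_congr ?_
    filter_upwards [ae_lebUnit_mem] with y hy
    change (invBranch P k y ∈ D ∧ doublingMap^[P] (invBranch P k y) ∈ A) = (y ∈ A)
    simp [hmem y hy, h, iterate_invBranch hk hy]
  · rw [Set.indicator_of_notMem h, zero_mul, ← measureReal_empty (μ := lebUnit)]
    refine measureReal_congr ?_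
    filter_upwards [ae_lebUnit_mem] with y hy
    change (invBranch P k y ∈ D ∧ doublingMap^[P] (invBranch P k y) ∈ A) = (y ∈ (∅ : Set ℝ))
    simp [hmem y hy, h]

/-- On each branch of `f^P` the set `D` is everything or nothing, while the preimage of `A` pulls
back to `A`. Taking `A = univ` identifies the proportion of branches inside `D` as its measure. -/
theorem measureReal_inter_preimage (hD : IsDyadicSet P D) {A : Set ℝ} (hA : MeasurableSet A) :
    lebUnit.real (D ∩ doublingMap^[P] ⁻¹' A) = lebUnit.real D * lebUnit.real A := by
  have key : ∀ A : Set ℝ, MeasurableSet A → lebUnit.real (D ∩ doublingMap^[P] ⁻¹' A) =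
      (2 ^ P)⁻¹ * (∑ k ∈ Finset.range (2 ^ P), D.indicator (fun _ => 1) (invBranch P k 0)) *
        lebUnit.real A := by
    intro A hA
    rw [measureReal_lebUnit_eq_sum P
      (hD.measurableSet.inter (measurable_iterate_doublingMap P hA)), mul_assoc, Finset.sum_mul]
    congr 1
    exact Finset.sum_congr rfl fun k hk =>
      hD.measureReal_preimage_invBranch (Finset.mem_range.1 hk)
  have h1 := key Set.univ MeasurableSet.univ
  rw [Set.preimage_univ, Set.inter_univ, probReal_univ, mul_one] at h1
  rw [key A hA, h1]

theorem measureReal_forall_iterate_mem (hD : IsDyadicSet P D) (q : ℕ) :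
    lebUnit.real {y | ∀ t < q, doublingMap^[t * P] y ∈ D} = lebUnit.real D ^ q := by
  induction q with
  | zero => simp
  | succ q ih =>
    have hset : {y | ∀ t < q + 1, doublingMap^[t * P] y ∈ D} =
        D ∩ doublingMap^[P] ⁻¹' {y | ∀ t < q, doublingMap^[t * P] y ∈ D} := by
      ext y
      simp only [Set.mem_ofPred_eq, Set.mem_inter_iff, Set.mem_preimage,
        ← Function.iterate_add_apply]
      constructor
      · intro h
        refine ⟨by simpa using h 0 (by omega), fun t ht => ?_⟩
        have := h (t + 1) (by omega)
        rwa [add_mul, one_mul] at this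
      · rintro ⟨h0, h⟩ t ht
        rcases t with _ | t
        · simpa using h0
        · have := h t (by omega)
          rwa [add_mul, one_mul]
    have hmeas : MeasurableSet {y | ∀ t < q, doublingMap^[t * P] y ∈ D} := by
      simp only [Set.ofPred_forall]
      exact MeasurableSet.iInter fun t => MeasurableSet.iInter fun _ =>
        measurable_iterate_doublingMap _ hD.measurableSet
    rw [hset, hD.measureReal_inter_preimage hmeas, ih, pow_succ']

end IsDyadicSet

/-! ### Probability of hitting a set along the orbit. -/

/-- The sum of the short-return correlations `μ(B ∩ f⁻ʲ B)` for `1 ≤ j ≤ L`. -/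
noncomputable def returnSum (L : ℕ) (B : Set ℝ) : ℝ :=
  ∑ j ∈ Finset.Icc 1 L, lebUnit.real (B ∩ doublingMap^[j] ⁻¹' B)

/-- Bonferroni: time `L` adds `μ(B)` minus its overlap with earlier visits, and by invariance that
overlap involves distinct lags `L - i`. Keeping `K` fixed lets the same correlation sum serve
throughout the induction. -/
theorem le_measureReal_exists_iterate_mem {B : Set ℝ} (hB : MeasurableSet B) {K L : ℕ}
    (hLK : L ≤ K) :
    L * (lebUnit.real B - returnSum K B) ≤
      lebUnit.real {y | ∃ i < L, doublingMap^[i] y ∈ B} := by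
  induction L with
  | zero => simp
  | succ L ih =>
    set U := {y | ∃ i < L, doublingMap^[i] y ∈ B} with hU
    set V := doublingMap^[L] ⁻¹' B with hV
    have hVm : MeasurableSet V := measurable_iterate_doublingMap L hB
    have hset : {y | ∃ i < L + 1, doublingMap^[i] y ∈ B} = U ∪ V := by
      ext y
      simp only [hU, hV, Set.mem_ofPred_eq, Set.mem_union, Set.mem_preimage, Nat.lt_succ_iff]
      constructor
      · rintro ⟨i, hi, h⟩
        rcases hi.lt_or_eq with hi | rfl
        · exact Or.inl ⟨i, hi, h⟩
        · exact Or.inr h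
      · rintro (⟨i, hi, h⟩ | h)
        · exact ⟨i, hi.le, h⟩
        · exact ⟨L, le_rfl, h⟩
    have hVreal : lebUnit.real V = lebUnit.real B :=
      (measurePreserving_iterate_doublingMap L).measureReal_preimage hB.nullMeasurableSet
    have hinter : lebUnit.real (U ∩ V) ≤ returnSum K B := by
      have hsub : U ∩ V ⊆ ⋃ i ∈ Finset.range L, (doublingMap^[i] ⁻¹' B ∩ V) := by
        rintro y ⟨⟨i, hi, h⟩, hv⟩
        simp only [Set.mem_iUnion]
        exact ⟨i, Finset.mem_range.2 hi, h, hv⟩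
      calc lebUnit.real (U ∩ V)
          ≤ ∑ i ∈ Finset.range L, lebUnit.real (doublingMap^[i] ⁻¹' B ∩ V) :=
            (measureReal_mono hsub (measure_ne_top _ _)).trans (measureReal_biUnion_finset_le _ _)
        _ = ∑ i ∈ Finset.range L, lebUnit.real (B ∩ doublingMap^[L - i] ⁻¹' B) := by
            refine Finset.sum_congr rfl fun i hi => ?_
            have hi := Finset.mem_range.1 hi
            rw [← (measurePreserving_iterate_doublingMap i).measureReal_preimage
              (hB.inter (measurable_iterate_doublingMap (L - i) hB)).nullMeasurableSet,
              Set.preimage_inter, ← Set.preimage_comp, ← Function.iterate_add,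
              Nat.sub_add_cancel hi.le]
        _ = ∑ j ∈ (Finset.range L).image (fun i => L - i),
              lebUnit.real (B ∩ doublingMap^[j] ⁻¹' B) := by
            rw [Finset.sum_image]
            intro i hi j hj h
            simp only [Finset.coe_range, Set.mem_Iio] at hi hj
            simp only at h
            omega
        _ ≤ returnSum K B := by
            refine Finset.sum_le_sum_of_subset_of_nonneg ?_ fun _ _ _ => measureReal_nonneg
            intro j hj
            simp only [Finset.mem_image, Finset.mem_range, Finset.mem_Icc] at hj ⊢
            omega
    have hunion := measureReal_union_add_inter (μ := lebUnit) (s := U) hVm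
    have := ih (by omega)
    rw [hset]
    push_cast
    rw [hVreal] at hunion
    linarith

/-- Avoiding `B` at the first `L` times depends on `L + M` binary digits only, so blocks of that
length are independent; `1 - t ≤ exp (-t)` does the rest, whatever the sign of `t`. -/
theorem measureReal_forall_iterate_notMem_le {M : ℕ} {B : Set ℝ} (hB : IsDyadicSet M B)
    (L q : ℕ) :
    lebUnit.real {y | ∀ i < q * (L + M), doublingMap^[i] y ∉ B} ≤
      Real.exp (-(q * L * (lebUnit.real B - returnSum L B))) := by
  set D := ⋂ i : Fin L, (doublingMap^[(i : ℕ)] ⁻¹' Bᶜ) with hDdef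
  have hD : IsDyadicSet (L + M) D :=
    IsDyadicSet.iInter fun i => (hB.compl.preimage_iterate i).mono (by omega)
  have hDc : Dᶜ = {y | ∃ i < L, doublingMap^[i] y ∈ B} := by
    ext y
    simp [hDdef, Fin.exists_iff]
  have hDle : lebUnit.real D ≤ Real.exp (-(L * (lebUnit.real B - returnSum L B))) := by
    have h1 := le_measureReal_exists_iterate_mem hB.measurableSet (le_refl L)
    rw [← hDc, probReal_compl_eq_one_sub hD.measurableSet] at h1
    have h2 := Real.add_one_le_exp (-(L * (lebUnit.real B - returnSum L B)))
    linarith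
  have hsub : {y | ∀ i < q * (L + M), doublingMap^[i] y ∉ B} ⊆
      {y | ∀ t < q, doublingMap^[t * (L + M)] y ∈ D} := by
    intro y hy t ht
    simp only [hDdef, Set.mem_iInter, Set.mem_preimage, ← Function.iterate_add_apply]
    intro i
    refine hy _ ?_
    calc (i : ℕ) + t * (L + M) < (t + 1) * (L + M) := by rw [add_mul]; omega
      _ ≤ q * (L + M) := Nat.mul_le_mul_right _ ht
  calc _ ≤ _ := measureReal_mono hsub
    _ = lebUnit.real D ^ q := hD.measureReal_forall_iterate_mem q
    _ ≤ Real.exp (-(L * (lebUnit.real B - returnSum L B))) ^ q := by gcongr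
    _ = _ := by rw [← Real.exp_nat_mul]; congr 1; ring

/-! ### Dyadic cells and their neighbourhoods. -/

/-- The `a`-th dyadic interval of length `2⁻ᴹ`. -/
def dyadicCell (M a : ℕ) : Set ℝ := {x | ⌊2 ^ M * x⌋ = (a : ℤ)}

/-- The union of the dyadic intervals of length `2⁻ᴹ` at index distance at most `m` from the
`a`-th one. -/
def dyadicNhd (M m a : ℕ) : Set ℝ := {x | |⌊2 ^ M * x⌋ - (a : ℤ)| ≤ m}

theorem isDyadicSet_floor (M : ℕ) (S : Set ℤ) : IsDyadicSet M {x | ⌊(2 : ℝ) ^ M * x⌋ ∈ S} :=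
  ⟨(Int.measurable_floor.comp (measurable_const.mul measurable_id)) (MeasurableSet.of_discrete),
    fun x _ y _ h => by simp [h]⟩

theorem isDyadicSet_dyadicCell (M a : ℕ) : IsDyadicSet M (dyadicCell M a) :=
  isDyadicSet_floor M {(a : ℤ)}

theorem isDyadicSet_dyadicNhd (M m a : ℕ) : IsDyadicSet M (dyadicNhd M m a) :=
  isDyadicSet_floor M {k : ℤ | |k - (a : ℤ)| ≤ m}

theorem exists_mem_dyadicCell (M : ℕ) {x : ℝ} (hx : x ∈ Set.Ico (0 : ℝ) 1) :
    ∃ k < 2 ^ M, x ∈ dyadicCell M k := by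
  have h0 : 0 ≤ ⌊2 ^ M * x⌋ := Int.floor_nonneg.2 (mul_nonneg (by positivity) hx.1)
  have h1 : ⌊2 ^ M * x⌋ < (2 ^ M : ℕ) := by
    rw [Int.floor_lt]
    push_cast
    exact mul_lt_of_lt_one_right (by positivity) hx.2
  refine ⟨⌊2 ^ M * x⌋.toNat, by omega, ?_⟩
  change ⌊2 ^ M * x⌋ = _
  omega

theorem measureReal_eq_sum_dyadicCell (M : ℕ) {E : Set ℝ} (hE : MeasurableSet E) :
    lebUnit.real E = ∑ k ∈ Finset.range (2 ^ M), lebUnit.real (E ∩ dyadicCell M k) := by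
  rw [← measureReal_biUnion_finset]
  · refine measureReal_congr ?_
    filter_upwards [ae_lebUnit_mem] with x hx
    change (x ∈ E) = (x ∈ ⋃ k ∈ Finset.range (2 ^ M), E ∩ dyadicCell M k)
    obtain ⟨k, hk, hxk⟩ := exists_mem_dyadicCell M hx
    simp only [Set.mem_iUnion, Finset.mem_range, eq_iff_iff, Set.mem_inter_iff]
    exact ⟨fun h => ⟨k, hk, h, hxk⟩, fun ⟨_, _, h, _⟩ => h⟩
  · intro i _ j _ hij
    refine Set.disjoint_left.2 fun x hx hx' => hij ?_
    have h1 : ⌊2 ^ M * x⌋ = (i : ℤ) := hx.2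
    have h2 : ⌊2 ^ M * x⌋ = (j : ℤ) := hx'.2
    omega
  · exact fun k _ => hE.inter (isDyadicSet_dyadicCell M k).measurableSet

theorem measureReal_dyadicCell {M a : ℕ} (ha : a < 2 ^ M) :
    lebUnit.real (dyadicCell M a) = (2 ^ M)⁻¹ := by
  rw [measureReal_lebUnit_eq_sum M (isDyadicSet_dyadicCell M a).measurableSet]
  have : ∀ k ∈ Finset.range (2 ^ M), lebUnit.real (invBranch M k ⁻¹' dyadicCell M a) =
      if k = a then 1 else 0 := by
    intro k _
    have h : (invBranch M k ⁻¹' dyadicCell M a) =ᵐ[lebUnit] {_y : ℝ | k = a} := by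
      filter_upwards [ae_lebUnit_mem] with y hy
      change (⌊2 ^ M * invBranch M k y⌋ = (a : ℤ)) = (k = a)
      rw [floor_invBranch M k hy]
      simp
    rw [measureReal_congr h]
    by_cases hka : k = a <;> simp [hka]
  rw [Finset.sum_congr rfl this]
  simp [ha]

theorem measureReal_inter_dyadicNhd (M m a : ℕ) {E : Set ℝ} (hE : MeasurableSet E) :
    lebUnit.real (dyadicNhd M m a ∩ E) = ∑ k ∈ Finset.range (2 ^ M),
      if |(k : ℤ) - a| ≤ m then lebUnit.real (E ∩ dyadicCell M k) else 0 := by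
  rw [measureReal_eq_sum_dyadicCell M ((isDyadicSet_dyadicNhd M m a).measurableSet.inter hE)]
  refine Finset.sum_congr rfl fun k _ => ?_
  split_ifs with h
  · congr 1
    ext x
    simp only [dyadicNhd, dyadicCell, Set.mem_inter_iff, Set.mem_ofPred_eq]
    constructor
    · rintro ⟨⟨_, hx⟩, hk⟩; exact ⟨hx, hk⟩
    · rintro ⟨hx, hk⟩; exact ⟨⟨hk ▸ h, hx⟩, hk⟩
  · convert measureReal_empty (μ := lebUnit)
    refine Set.eq_empty_of_forall_notMem fun x hx => h ?_
    have hk : ⌊2 ^ M * x⌋ = (k : ℤ) := hx.2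
    exact hk ▸ hx.1.1

theorem card_filter_abs_sub_le (N m k : ℕ) :
    ((Finset.range N).filter fun a : ℕ => |(k : ℤ) - a| ≤ m).card ≤ 2 * m + 1 := by
  calc _ ≤ (Finset.Icc (k - m) (k + m)).card := by
        refine Finset.card_le_card fun a ha => ?_
        simp only [Finset.mem_filter, Finset.mem_range, abs_le, Finset.mem_Icc] at ha ⊢
        omega
    _ ≤ 2 * m + 1 := by rw [Nat.card_Icc]; omega

/-- Each cell lies in at most `2 * m + 1` of the neighbourhoods. -/
theorem sum_measureReal_inter_dyadicNhd_le (M m : ℕ) {E : Set ℝ} (hE : MeasurableSet E) :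
    ∑ a ∈ Finset.range (2 ^ M), lebUnit.real (dyadicNhd M m a ∩ E) ≤
      (2 * m + 1) * lebUnit.real E := by
  simp_rw [measureReal_inter_dyadicNhd M m _ hE]
  rw [Finset.sum_comm, measureReal_eq_sum_dyadicCell M hE, Finset.mul_sum]
  refine Finset.sum_le_sum fun k _ => ?_
  rw [← Finset.sum_filter, Finset.sum_const, nsmul_eq_mul]
  gcongr
  exact_mod_cast card_filter_abs_sub_le _ m k

theorem measureReal_dyadicNhd {M m a : ℕ} (h₁ : m ≤ a) (h₂ : a + m < 2 ^ M) :
    lebUnit.real (dyadicNhd M m a) = (2 * m + 1) / 2 ^ M := by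
  have h := measureReal_inter_dyadicNhd M m a MeasurableSet.univ
  rw [Set.inter_univ] at h
  have hf : ((Finset.range (2 ^ M)).filter fun k : ℕ => |(k : ℤ) - a| ≤ m) =
      Finset.Icc (a - m) (a + m) := by
    ext k
    simp only [Finset.mem_filter, Finset.mem_range, abs_le, Finset.mem_Icc]
    omega
  have hc : ∀ k ∈ Finset.Icc (a - m) (a + m),
      lebUnit.real (Set.univ ∩ dyadicCell M k) = (2 ^ M)⁻¹ := by
    intro k hk
    rw [Set.univ_inter, measureReal_dyadicCell]
    have := (Finset.mem_Icc.1 hk).2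
    omega
  rw [h, ← Finset.sum_filter, hf, Finset.sum_congr rfl hc, Finset.sum_const, Nat.card_Icc,
    nsmul_eq_mul, ← div_eq_mul_inv]
  congr 1
  have : a + m + 1 - (a - m) = 2 * m + 1 := by omega
  rw [this]
  push_cast
  rfl

theorem card_filter_boundary_le (N m : ℕ) :
    ((Finset.range N).filter fun a => ¬ (m ≤ a ∧ a + m < N)).card ≤ 2 * m := by
  calc _ ≤ (Finset.range m ∪ Finset.Ico (N - m) N).card := by
        refine Finset.card_le_card fun a ha => ?_
        simp only [Finset.mem_filter, Finset.mem_range, Finset.mem_union, Finset.mem_Ico] at ha ⊢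
        omega
    _ ≤ m + (N - (N - m)) := by
        refine (Finset.card_union_le _ _).trans ?_
        rw [Finset.card_range, Nat.card_Ico]
    _ ≤ 2 * m := by omega

theorem dist_lt_of_mem_dyadicNhd {M m a : ℕ} {x y : ℝ} (hx : x ∈ dyadicCell M a)
    (hy : y ∈ dyadicNhd M m a) : dist y x < (m + 1) / 2 ^ M := by
  have h2 : (0 : ℝ) < 2 ^ M := by positivity
  have hx' : ⌊2 ^ M * x⌋ = (a : ℤ) := hx
  have hy' : |⌊2 ^ M * y⌋ - (a : ℤ)| ≤ m := hy
  rw [← hx', abs_le] at hy'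
  have ha : (-(m : ℝ)) ≤ ⌊2 ^ M * y⌋ - ⌊2 ^ M * x⌋ := by exact_mod_cast hy'.1
  have hb : (⌊2 ^ M * y⌋ : ℝ) - ⌊2 ^ M * x⌋ ≤ m := by exact_mod_cast hy'.2
  have := Int.floor_le (2 ^ M * x)
  have := Int.lt_floor_add_one (2 ^ M * x)
  have := Int.floor_le (2 ^ M * y)
  have := Int.lt_floor_add_one (2 ^ M * y)
  rw [Real.dist_eq, abs_lt, ← neg_div, div_lt_iff₀ h2, lt_div_iff₀ h2]
  constructor <;> linarith

theorem dist_le_of_mem_dyadicNhd {M m a : ℕ} {x y : ℝ} (hx : x ∈ dyadicNhd M m a)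
    (hy : y ∈ dyadicNhd M m a) : dist x y ≤ 2 * ((m + 1) / 2 ^ M) := by
  have h2 : (0 : ℝ) < 2 ^ M := by positivity
  have hz : (a : ℝ) / 2 ^ M ∈ dyadicCell M a := by
    change ⌊2 ^ M * ((a : ℝ) / 2 ^ M)⌋ = (a : ℤ)
    rw [mul_div_cancel₀ _ h2.ne', Int.floor_natCast]
  have h3 := dist_lt_of_mem_dyadicNhd hz hx
  have h4 := dist_lt_of_mem_dyadicNhd hz hy
  have h5 := dist_triangle_right x y ((a : ℝ) / 2 ^ M)
  linarith

/-- A point of `B ∩ f⁻ʲB` is within the diameter bound of `B` of its `j`-th iterate, so the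
correlations are controlled, on average over cells, by the short return estimate. -/
theorem sum_returnSum_dyadicNhd_le (M m L : ℕ) :
    ∑ a ∈ Finset.range (2 ^ M), returnSum L (dyadicNhd M m a) ≤
      L * ((2 * m + 1) * (8 * ((m + 1) / 2 ^ M))) := by
  unfold returnSum
  rw [Finset.sum_comm]
  have key : ∀ j ∈ Finset.Icc 1 L, ∑ a ∈ Finset.range (2 ^ M),
      lebUnit.real (dyadicNhd M m a ∩ doublingMap^[j] ⁻¹' dyadicNhd M m a) ≤
      (2 * m + 1) * (8 * ((m + 1) / 2 ^ M)) := by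
    intro j hj
    set R := returnSet (Set.Ico 0 1) doublingMap j (2 * ((m + 1) / 2 ^ M)) with hR
    calc _ ≤ ∑ a ∈ Finset.range (2 ^ M), lebUnit.real (dyadicNhd M m a ∩ R) := by
          refine Finset.sum_le_sum fun a _ =>
            ENNReal.toReal_mono (measure_ne_top _ _) (measure_mono_ae ?_)
          filter_upwards [ae_lebUnit_mem] with x hx hxm
          exact ⟨hxm.1, hx, dist_le_of_mem_dyadicNhd hxm.1 hxm.2⟩
      _ ≤ (2 * m + 1) * lebUnit.real R :=
          sum_measureReal_inter_dyadicNhd_le M m (measurableSet_returnSet j _)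
      _ ≤ (2 * m + 1) * (4 * (2 * ((m + 1) / 2 ^ M))) := by
          gcongr
          exact measureReal_returnSet_le (Finset.mem_Icc.1 hj).1 (by positivity)
      _ = _ := by ring
  refine (Finset.sum_le_sum key).trans ?_
  simp

/-! ### Measure of the non-returning points. -/

/-- The points that do not come back within `r` of themselves up to time `n`. -/
def noReturnSet (n : ℕ) (r : ℝ) : Set ℝ :=
  {x | ∀ j, 1 ≤ j → j ≤ n → r ≤ dist (doublingMap^[j] x) x}

theorem measurableSet_noReturnSet (n : ℕ) (r : ℝ) : MeasurableSet (noReturnSet n r) := by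
  simp only [noReturnSet, Set.ofPred_forall]
  exact MeasurableSet.iInter fun j => MeasurableSet.iInter fun _ => MeasurableSet.iInter fun _ =>
    measurableSet_le measurable_const ((measurable_iterate_doublingMap j).dist measurable_id)

theorem measureReal_noReturnSet_inter_dyadicCell_le {M m L q n a : ℕ} (hM : 1 ≤ M)
    (hn : M + q * (L + M) ≤ n) (ha : a < 2 ^ M) :
    lebUnit.real (noReturnSet n ((m + 1) / 2 ^ M) ∩ dyadicCell M a) ≤ (2 ^ M)⁻¹ *
      Real.exp (-(q * L * (lebUnit.real (dyadicNhd M m a) - returnSum L (dyadicNhd M m a)))) := by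
  set B := dyadicNhd M m a with hB
  have hBd : IsDyadicSet M B := isDyadicSet_dyadicNhd M m a
  set G := {y | ∀ i < q * (L + M), doublingMap^[i] y ∉ B} with hG
  have hGm : MeasurableSet G := by
    simp only [hG, Set.ofPred_forall]
    exact MeasurableSet.iInter fun i => MeasurableSet.iInter fun _ =>
      (measurable_iterate_doublingMap i hBd.measurableSet).compl
  have hsub : noReturnSet n ((m + 1) / 2 ^ M) ∩ dyadicCell M a ⊆
      dyadicCell M a ∩ doublingMap^[M] ⁻¹' G := by
    rintro x ⟨hx, hxa⟩
    refine ⟨hxa, fun i hi hmem => ?_⟩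
    rw [← Function.iterate_add_apply] at hmem
    exact absurd (dist_lt_of_mem_dyadicNhd hxa hmem)
      -- The relevant times are `i + M`: at least `1` by `hM`, at most `n` by `hn`.
      (not_lt.2 (hx (i + M) (by omega) (by omega)))
  calc _ ≤ _ := measureReal_mono hsub
    _ = (2 ^ M)⁻¹ * lebUnit.real G := by
      rw [(isDyadicSet_dyadicCell M a).measureReal_inter_preimage hGm, measureReal_dyadicCell ha]
    _ ≤ _ := by
      gcongr
      exact measureReal_forall_iterate_notMem_le hBd L q

theorem measureReal_noReturnSet_le {M m L q n : ℕ} (hM : 1 ≤ M) (hn : M + q * (L + M) ≤ n)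
    {ε : ℝ} (hε : 0 < ε) :
    lebUnit.real (noReturnSet n ((m + 1) / 2 ^ M)) ≤
      Real.exp (-(q * L * ((1 - ε) * ((2 * m + 1) / 2 ^ M)))) +
        (m + 1) / 2 ^ M * (2 + 8 * L / ε) := by
  have h2 : (0 : ℝ) < 2 ^ M := by positivity
  set E := noReturnSet n ((m + 1) / 2 ^ M) with hE
  set b : ℝ := (2 * m + 1) / 2 ^ M with hb
  have hb0 : 0 < b := by positivity
  set X := Real.exp (-(q * L * ((1 - ε) * b))) with hX
  -- The three terms cover good cells, cells whose neighbourhood leaves `[0,1)`, and cells with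
  -- correlation sum above `ε * b`, the last in Markov form.
  have hcell : ∀ a ∈ Finset.range (2 ^ M), lebUnit.real (E ∩ dyadicCell M a) ≤ (2 ^ M)⁻¹ *
      (X + (if ¬ (m ≤ a ∧ a + m < 2 ^ M) then 1 else 0) +
        returnSum L (dyadicNhd M m a) / (ε * b)) := by
    intro a ha
    have ha := Finset.mem_range.1 ha
    have hs0 : 0 ≤ returnSum L (dyadicNhd M m a) :=
      Finset.sum_nonneg fun _ _ => measureReal_nonneg
    have hs0' : 0 ≤ returnSum L (dyadicNhd M m a) / (ε * b) := by positivity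
    have hX0 : 0 ≤ X := (Real.exp_pos _).le
    have htriv : lebUnit.real (E ∩ dyadicCell M a) ≤ (2 ^ M)⁻¹ * 1 := by
      rw [mul_one, ← measureReal_dyadicCell ha]
      exact measureReal_mono Set.inter_subset_right
    by_cases h1 : m ≤ a ∧ a + m < 2 ^ M
    · rw [if_neg (not_not.2 h1), add_zero]
      by_cases h3 : returnSum L (dyadicNhd M m a) ≤ ε * b
      · refine (measureReal_noReturnSet_inter_dyadicCell_le hM hn ha).trans ?_
        rw [measureReal_dyadicNhd h1.1 h1.2, ← hb]
        gcongr
        refine le_trans ?_ (le_add_of_nonneg_right hs0')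
        rw [hX]
        gcongr
        linarith
      · refine htriv.trans ?_
        gcongr
        refine le_trans ?_ (le_add_of_nonneg_left hX0)
        rw [one_le_div (by positivity)]
        exact (not_le.1 h3).le
    · rw [if_pos h1]
      refine htriv.trans ?_
      gcongr
      linarith
  rw [measureReal_eq_sum_dyadicCell M (measurableSet_noReturnSet n _)]
  refine (Finset.sum_le_sum hcell).trans ?_
  rw [← Finset.mul_sum, Finset.sum_add_distrib, Finset.sum_add_distrib, ← Finset.sum_div,
    Finset.sum_const, Finset.card_range, Finset.sum_boole, nsmul_eq_mul]
  have hc : (((Finset.range (2 ^ M)).filter fun a => ¬ (m ≤ a ∧ a + m < 2 ^ M)).card : ℝ) ≤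
      2 * m := by exact_mod_cast card_filter_boundary_le (2 ^ M) m
  have hs : (∑ a ∈ Finset.range (2 ^ M), returnSum L (dyadicNhd M m a)) / (ε * b) ≤
      8 * L / ε * (m + 1) := by
    rw [div_le_iff₀ (by positivity)]
    refine (sum_returnSum_dyadicNhd_le M m L).trans (le_of_eq ?_)
    rw [hb]
    field_simp
  calc _ ≤ (2 ^ M)⁻¹ * ((2 ^ M : ℕ) * X + 2 * (m + 1) + 8 * L / ε * (m + 1)) := by
        gcongr
        linarith
    _ = _ := by
        push_cast
        field_simp
        ring

/-! ### Asymptotics along the times `l ^ k`. -/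

/-- The return threshold `c log log (l ^ k) / l ^ (k + 1)` along a geometric sequence of times. -/
noncomputable def geomThreshold (c l : ℝ) (k : ℕ) : ℝ := c * Real.log (k * Real.log l) / l ^ (k + 1)

/-- The number of independent blocks of length `k² + k` up to time `l ^ k`. -/
noncomputable def blockCount (l : ℝ) (k : ℕ) : ℕ := ⌊(l ^ k - k) / ((k : ℝ) ^ 2 + k)⌋₊

/-- The threshold in units of `2⁻ᵏ`. -/
noncomputable def dyadicRadius (c l : ℝ) (k : ℕ) : ℕ := ⌊geomThreshold c l k * 2 ^ k⌋₊ - 1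

section asymptotics

variable {c l : ℝ}

theorem tendsto_log_natCast_atTop : Tendsto (fun k : ℕ => Real.log k) atTop atTop :=
  Real.tendsto_log_atTop.comp tendsto_natCast_atTop_atTop

theorem tendsto_log_mul_log_atTop (hl : 1 < l) :
    Tendsto (fun k : ℕ => Real.log (k * Real.log l)) atTop atTop :=
  Real.tendsto_log_atTop.comp
    (tendsto_natCast_atTop_atTop.atTop_mul_const (Real.log_pos hl))

theorem eventually_one_le_geomThreshold_mul (hc : 0 < c) (hl : 1 < l) (hl2 : l < 2) :
    ∀ᶠ k : ℕ in atTop, 1 ≤ geomThreshold c l k * 2 ^ k := by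
  have hl0 : 0 < l := one_pos.trans hl
  have h1 : Tendsto (fun k : ℕ => c / l * Real.log (k * Real.log l)) atTop atTop :=
    (tendsto_log_mul_log_atTop hl).const_mul_atTop (by positivity)
  filter_upwards [h1.eventually_ge_atTop 1] with k hk
  have h2 : 1 ≤ (2 / l) ^ k := one_le_pow₀ ((one_le_div hl0).2 hl2.le)
  have : geomThreshold c l k * 2 ^ k = c / l * Real.log (k * Real.log l) * (2 / l) ^ k := by
    rw [geomThreshold, div_pow, pow_succ]
    field_simp
  rw [this]
  exact one_le_mul_of_one_le_of_one_le hk h2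

theorem dyadicRadius_add_one_le {k : ℕ} (h : 1 ≤ geomThreshold c l k * 2 ^ k) :
    ((dyadicRadius c l k : ℝ) + 1) / 2 ^ k ≤ geomThreshold c l k := by
  rw [div_le_iff₀ (by positivity)]
  have h1 : 1 ≤ ⌊geomThreshold c l k * 2 ^ k⌋₊ := Nat.le_floor (by simpa using h)
  have h2 := Nat.floor_le (zero_le_one.trans h)
  rw [dyadicRadius]
  push_cast [h1]
  linarith

/-- The loss `3 / 2 ^ k` is twice the rounding error plus the `1` subtracted in `2 ⌊·⌋ - 1`; it is
negligible because `l < 2` in the applications. -/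
theorem le_two_mul_dyadicRadius {k : ℕ} (h : 1 ≤ geomThreshold c l k * 2 ^ k) :
    2 * geomThreshold c l k - 3 / 2 ^ k ≤ (2 * (dyadicRadius c l k : ℝ) + 1) / 2 ^ k := by
  rw [le_div_iff₀ (by positivity), sub_mul, div_mul_cancel₀ _ (by positivity)]
  have h1 : 1 ≤ ⌊geomThreshold c l k * 2 ^ k⌋₊ := Nat.le_floor (by simpa using h)
  have h2 := Nat.lt_floor_add_one (geomThreshold c l k * 2 ^ k)
  rw [dyadicRadius]
  push_cast [h1]
  linarith

theorem eventually_natCast_le_pow (hl : 1 < l) : ∀ᶠ k : ℕ in atTop, (k : ℝ) ≤ l ^ k := by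
  have := tendsto_pow_const_div_const_pow_of_one_lt 1 hl
  filter_upwards [this.eventually (gt_mem_nhds one_pos)] with k hk
  rw [pow_one, div_lt_one (by positivity)] at hk
  exact hk.le

theorem add_blockCount_mul_le {k : ℕ} (hk : 1 ≤ k) (h : (k : ℝ) ≤ l ^ k) :
    k + blockCount l k * (k ^ 2 + k) ≤ ⌈l ^ k⌉₊ := by
  have hk' : (0 : ℝ) < k := by exact_mod_cast hk
  have h1 : (blockCount l k : ℝ) ≤ (l ^ k - k) / ((k : ℝ) ^ 2 + k) :=
    Nat.floor_le (div_nonneg (by linarith) (by positivity))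
  rw [le_div_iff₀ (by positivity)] at h1
  have h2 := Nat.le_ceil (l ^ k)
  have : ((k + blockCount l k * (k ^ 2 + k) : ℕ) : ℝ) ≤ (⌈l ^ k⌉₊ : ℝ) := by
    push_cast
    linarith
  exact_mod_cast this

theorem tendsto_blockCount_aux (hl : 1 < l) :
    Tendsto (fun k : ℕ => ((l ^ k - k) / ((k : ℝ) ^ 2 + k) - 1) * k ^ 2 / l ^ k)
      atTop (nhds 1) := by
  have h1 := tendsto_pow_const_div_const_pow_of_one_lt 1 hl
  have h2 := tendsto_pow_const_div_const_pow_of_one_lt 2 hl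
  have h3 : Tendsto (fun k : ℕ => (k : ℝ) / (k + 1)) atTop (nhds 1) :=
    tendsto_natCast_div_add_atTop 1
  have h4 := ((h1.const_sub 1).mul h3).sub h2
  rw [sub_zero, mul_one, sub_zero] at h4
  refine h4.congr' ?_
  filter_upwards [eventually_ge_atTop 1] with k hk
  have hk' : (0 : ℝ) < k := by exact_mod_cast hk
  have hl0 : 0 < l := one_pos.trans hl
  field_simp

theorem tendsto_geomThreshold_aux (hl : 1 < l) (hl2 : l < 2) :
    Tendsto (fun k : ℕ => (2 * geomThreshold c l k - 3 / 2 ^ k) * l ^ k / Real.log k)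
      atTop (nhds (2 * c / l)) := by
  have hl0 : 0 < l := one_pos.trans hl
  have hlog := tendsto_log_natCast_atTop
  have h1 : Tendsto (fun k : ℕ => Real.log (Real.log l) / Real.log k) atTop (nhds 0) :=
    hlog.const_div_atTop _
  have h2 : Tendsto (fun k : ℕ => 3 / Real.log k) atTop (nhds 0) := hlog.const_div_atTop _
  have h3 : Tendsto (fun k : ℕ => (l / 2) ^ k) atTop (nhds 0) :=
    tendsto_pow_atTop_nhds_zero_of_lt_one (by positivity) (by linarith)
  have h4 := ((h1.const_add 1).const_mul (2 * c / l)).sub (h2.mul h3)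
  rw [add_zero, mul_one, mul_zero, sub_zero] at h4
  refine h4.congr' ?_
  filter_upwards [eventually_ge_atTop 2] with k hk
  have hk1 : (1 : ℝ) < k := by exact_mod_cast hk
  have hlk : 0 < Real.log k := Real.log_pos hk1
  rw [geomThreshold, Real.log_mul (by positivity) (Real.log_pos hl).ne', div_pow, pow_succ]
  field_simp

/-- This makes the exponential term of `measureReal_noReturnSet_le` at most `k ^ (-γ)`. -/
theorem eventually_mul_log_le (hl : 1 < l) (hl2 : l < 2) (hc : 0 < c) {ε γ : ℝ} (hε : ε < 1)
    (hγ : γ < (1 - ε) * (2 * c / l)) :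
    ∀ᶠ k : ℕ in atTop, γ * Real.log k ≤ blockCount l k * (k ^ 2 : ℕ) *
      ((1 - ε) * ((2 * (dyadicRadius c l k : ℝ) + 1) / 2 ^ k)) := by
  have hl0 : 0 < l := one_pos.trans hl
  have hu := tendsto_blockCount_aux hl
  have hv := tendsto_geomThreshold_aux (c := c) hl hl2
  have huv := (hu.mul hv).const_mul (1 - ε)
  rw [one_mul] at huv
  filter_upwards [huv.eventually (lt_mem_nhds hγ), hv.eventually (lt_mem_nhds (by positivity)),
    eventually_one_le_geomThreshold_mul hc hl hl2, eventually_ge_atTop 2] with k h1 h2 h3 hk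
  have hk1 : (1 : ℝ) < k := by exact_mod_cast hk
  have hlk : 0 < Real.log k := Real.log_pos hk1
  have hlp : 0 < l ^ k := by positivity
  have hε' : 0 < 1 - ε := by linarith
  set y := 2 * geomThreshold c l k - 3 / 2 ^ k with hy
  set x := (l ^ k - k) / ((k : ℝ) ^ 2 + k) - 1 with hx
  -- Needed to multiply the two lower bounds; it holds because the limit `2 * c / l` is positive.
  have hy0 : 0 ≤ y := by
    by_contra hneg
    exact absurd h2 (not_lt.2 (div_nonpos_of_nonpos_of_nonneg
      (mul_nonpos_of_nonpos_of_nonneg (not_le.1 hneg).le hlp.le) hlk.le))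
  have hxq : x ≤ blockCount l k := by
    have := Nat.lt_floor_add_one ((l ^ k - k) / ((k : ℝ) ^ 2 + k))
    rw [hx, blockCount]
    linarith
  calc γ * Real.log k
      ≤ (1 - ε) * (x * k ^ 2 / l ^ k * (y * l ^ k / Real.log k)) * Real.log k := by gcongr
    _ = (1 - ε) * k ^ 2 * (x * y) := by field_simp
    _ ≤ (1 - ε) * k ^ 2 * (blockCount l k * ((2 * (dyadicRadius c l k : ℝ) + 1) / 2 ^ k)) := by
        gcongr
        exact le_two_mul_dyadicRadius h3
    _ = _ := by push_cast; ring

theorem summable_geomThreshold_mul (hl : 1 < l) (hc : 0 < c) {ε : ℝ} (hε : 0 < ε) :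
    Summable fun k : ℕ =>
      c * (k * Real.log l) / l ^ (k + 1) * (2 + 8 * (k ^ 2 : ℕ) / ε) := by
  have hl0 : 0 < l := one_pos.trans hl
  have hr : ‖l⁻¹‖ < 1 := by
    rw [Real.norm_of_nonneg (by positivity)]
    exact inv_lt_one_of_one_lt₀ hl
  have h1 := (summable_pow_mul_geometric_of_norm_lt_one 1 hr).mul_left (2 * c * Real.log l / l)
  have h3 := (summable_pow_mul_geometric_of_norm_lt_one 3 hr).mul_left
    (8 * c * Real.log l / l / ε)
  refine (h1.add h3).congr fun k => ?_
  push_cast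
  rw [inv_pow, pow_succ l k]
  field_simp

end asymptotics

/-! ### Borel–Cantelli and interpolation. -/

theorem exists_geometric_noReturnSet_summable {c : ℝ} (hc : 1 / 2 < c) :
    ∃ l : ℝ, 1 < l ∧ l < 2 ∧ Summable fun k : ℕ =>
      lebUnit.real (noReturnSet ⌈l ^ k⌉₊ ((dyadicRadius c l k + 1) / 2 ^ k)) := by
  have hc0 : 0 < c := by linarith
  obtain ⟨l, hl, hlt⟩ := exists_between (lt_min one_lt_two (show 1 < 2 * c by linarith))
  obtain ⟨hl2, hlc⟩ := lt_min_iff.1 hlt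
  have hl0 : 0 < l := one_pos.trans hl
  have h1 : 1 < 2 * c / l := (one_lt_div hl0).2 hlc
  -- Here `a` plays the role of `1 - ε`, close enough to `1` that `a * (2 * c / l)` still exceeds
  -- `1`.
  obtain ⟨a, ha, ha1⟩ := exists_between (inv_lt_one_of_one_lt₀ h1)
  have hγ : 1 < a * (2 * c / l) := by
    rwa [inv_lt_iff_one_lt_mul₀ (by positivity)] at ha
  obtain ⟨γ, hγ1, hγ⟩ := exists_between hγ
  have ha0 : 0 < a := (by positivity : 0 < (2 * c / l)⁻¹).trans ha
  refine ⟨l, hl, hl2, ?_⟩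
  have hs1 : Summable fun k : ℕ => (k : ℝ) ^ (-γ) := by
    rw [Real.summable_nat_rpow]
    linarith
  have hs2 := summable_geomThreshold_mul hl hc0 (ε := 1 - a) (by linarith)
  refine Summable.of_norm_bounded_eventually_nat (hs1.add hs2) ?_
  filter_upwards [eventually_mul_log_le hl hl2 hc0 (ε := 1 - a) (by linarith)
      (by rwa [sub_sub_cancel]), eventually_one_le_geomThreshold_mul hc0 hl hl2,
    eventually_natCast_le_pow hl, eventually_ge_atTop 1] with k h1 h2 h3 hk
  have hk0 : (0 : ℝ) < k := by exact_mod_cast hk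
  have hlog : 0 < Real.log l := Real.log_pos hl
  have h8 : 0 ≤ 2 + 8 * ((k ^ 2 : ℕ) : ℝ) / (1 - a) := by
    have : 0 < 1 - a := by linarith
    positivity
  rw [Real.norm_of_nonneg measureReal_nonneg]
  refine (measureReal_noReturnSet_le (L := k ^ 2) hk (add_blockCount_mul_le hk h3)
    (ε := 1 - a) (by linarith)).trans (add_le_add ?_ ?_)
  · rw [Real.rpow_def_of_pos hk0, Real.exp_le_exp]
    linarith
  · refine mul_le_mul_of_nonneg_right ((dyadicRadius_add_one_le h2).trans ?_) h8
    rw [geomThreshold]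
    gcongr
    exact Real.log_le_self (by positivity)

theorem minReturn_lt_of_notMem_noReturnSet {n N : ℕ} {r x : ℝ} (hnN : n ≤ N)
    (hx : x ∉ noReturnSet n r) : minReturn doublingMap N x < r := by
  simp only [noReturnSet, Set.mem_ofPred_eq, not_forall, not_le] at hx
  obtain ⟨j, hj1, hjn, hlt⟩ := hx
  exact ((isLeast_minReturn doublingMap (hj1.trans (hjn.trans hnN)) x).2
    ⟨j, ⟨hj1, hjn.trans hnN⟩, rfl⟩).trans_lt hlt

/-- The threshold pairs the smallest numerator with the largest denominator on `[l^k, l^(k+1))`;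
hypothesis `h` makes the numerator positive, so the fractions compare. -/
theorem geomThreshold_le {c l : ℝ} (hc : 0 < c) (hl : 1 < l) {k n : ℕ}
    (h : 1 ≤ geomThreshold c l k * 2 ^ k) (hk : 1 ≤ k) (h1 : l ^ k ≤ n) (h2 : n < l ^ (k + 1)) :
    geomThreshold c l k ≤ c * Real.log (Real.log n) / n := by
  have hl0 : 0 < l := one_pos.trans hl
  have hn : (0 : ℝ) < n := (pow_pos hl0 k).trans_le h1
  have hk0 : (0 : ℝ) < k := by exact_mod_cast hk
  have hlog : 0 < Real.log l := Real.log_pos hl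
  have hpos : 0 < geomThreshold c l k :=
    pos_of_mul_pos_left (one_pos.trans_le h) (by positivity)
  have hnum : 0 < c * Real.log (k * Real.log l) := by
    rw [geomThreshold] at hpos
    exact (div_pos_iff_of_pos_right (by positivity)).1 hpos
  have hle : Real.log (k * Real.log l) ≤ Real.log (Real.log n) := by
    refine Real.log_le_log (by positivity) ?_
    rw [← Real.log_pow]
    exact Real.log_le_log (by positivity) h1
  have hle' := mul_le_mul_of_nonneg_left hle hc.le
  exact div_le_div₀ (hnum.le.trans hle') hle' hn h2.le

theorem ae_eventually_minReturn_lt {c : ℝ} (hc : 1 / 2 < c) :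
    ∀ᵐ x ∂lebUnit, ∀ᶠ n : ℕ in atTop,
      minReturn doublingMap n x < c * Real.log (Real.log n) / n := by
  have hc0 : 0 < c := by linarith
  obtain ⟨l, hl, hl2, hsum⟩ := exists_geometric_noReturnSet_summable hc
  have hne := hsum.tsum_ofReal_ne_top
  simp only [Measure.real, ENNReal.ofReal_toReal (measure_ne_top _ _)] at hne
  filter_upwards [ae_eventually_notMem hne] with x hx
  obtain ⟨K, hK⟩ := eventually_atTop.1 (hx.and
    ((eventually_one_le_geomThreshold_mul hc0 hl hl2).and (eventually_ge_atTop 1)))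
  filter_upwards [tendsto_natCast_atTop_atTop.eventually_ge_atTop (l ^ K),
    eventually_ge_atTop 1] with n hn hn1
  obtain ⟨k, hk1, hk2⟩ := exists_nat_pow_near (x := (n : ℝ)) (by exact_mod_cast hn1) hl
  have hKk : K ≤ k := by
    have := (pow_lt_pow_iff_right₀ hl).1 (hn.trans_lt hk2)
    omega
  obtain ⟨hxk, hr, hk⟩ := hK k hKk
  calc _ < _ := minReturn_lt_of_notMem_noReturnSet (Nat.ceil_le.2 hk1) hxk
    _ ≤ _ := dyadicRadius_add_one_le hr
    _ ≤ _ := geomThreshold_le hc0 hl hr hk hk1 hk2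

theorem isUpperBoundSequence_loglog {c : ℝ} (hc : 1 / 2 < c) :
    IsUpperBoundSequence (Set.Ico 0 1) (fun _ => 1)
      (fun n : ℕ => c * Real.log (Real.log n) / n) := by
  obtain ⟨c', h1, h2⟩ := exists_between hc
  refine ⟨fun _ _ => one_pos, 1, c', ⟨⟨0, by simp, rfl⟩, ?_⟩, by linarith, ?_⟩
  · rintro _ ⟨_, _, rfl⟩
    exact le_rfl
  · have hlim : Tendsto (fun n : ℕ => Real.log (Real.log n)) atTop atTop :=
      Real.tendsto_log_atTop.comp tendsto_log_natCast_atTop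
    filter_upwards [hlim.eventually_gt_atTop 0, eventually_ge_atTop 1] with n hn hn1
    have hn0 : (0 : ℝ) < n := by exact_mod_cast hn1
    gcongr

theorem mainTheorem6 (c : ℝ) (hc : 1 / 2 < c) :
    IsHyperbolicRecurrent (Set.Ico 0 1) doublingMap lebUnit (fun _ => 1) ∧
    IsUpperBoundSequence (Set.Ico 0 1) (fun _ => 1)
      (fun n : ℕ => c * Real.log (Real.log n) / n) ∧
    ∀ᵐ x ∂lebUnit, ∀ᶠ n : ℕ in atTop,
      minReturn doublingMap n x < c * Real.log (Real.log n) / n :=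
  ⟨isHyperbolicRecurrent_doublingMap, isUpperBoundSequence_loglog hc,
    ae_eventually_minReturn_lt hc⟩
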